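/- Let $QD_{16}=\langle a,x \mid a^8=x^2=1,\ xax=a^3\rangle$ be the quasidihedral group of order $16$, let $p$ be a prime, $q=p^n$, and let $F_q$ be a finite field with $q$ elements. Let $A=F_q[QD_{16}]$ be the group algebra, $U(A)$ its group of units, $J(A)$ its Jacobson radical, and $V=1+J(A)\trianglelefteq U(A)$. Write $C_m$ for the cyclic group of order $m$, $M(2,F)$ for the algebra of $2\times 2$ matrices over a field $F$, and $GL(2,F)$ for its unit group. 1. If $p=2$ (so $q=2^n$), then (a) $U(A)/V\cong C_{q-1}$; (b) $V$ is a $2$-group of order $2^{15n}$ and exponent $8$; (c) $V$ is nilpotent of class exactly $4$; (d) $V$ is centrally metabelian, that is, its second derived subgroup $V''$ is contained in the centre of $V$. 2. If $p>2$, then (a) if $q\equiv 1$ or $3 \pmod 8$, then $A\cong F_q^4\oplus M(2,F_q)^3$ as $F_q$-algebras, and $U(A)\cong C_{q-1}^4\times GL(2,F_q)^3$; (b) if $q\equiv -1$ or $-3 \pmod 8$, then $A\cong F_q^4\oplus M(2,F_q)\oplus M(2,F_{q^2})$ as $F_q$-algebras, where $F_{q^2}$ is a field extension of $F_q$ with $q^2$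 elements, and $U(A)\cong C_{q-1}^4\times GL(2,F_q)\times GL(2,F_{q^2})$. -/

import Mathlib

/-- The relators of the presentation
`⟨a, x | a ^ 2^(k-1) = 1, x ^ 2 = 1, x a x = a ^ (2^(k-2) - 1)⟩`,
where `a` and `x` are the free generators with index `0` and `1`. -/
def quasidihedralRels (k : ℕ) : Set (FreeGroup (Fin 2)) :=
  {FreeGroup.of 0 ^ 2 ^ (k - 1),
   FreeGroup.of 1 ^ 2,
   FreeGroup.of 1 * FreeGroup.of 0 * FreeGroup.of 1 *
     (FreeGroup.of 0 ^ (2 ^ (k - 2) - 1))⁻¹}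

/-- The quasidihedral group `QD_{2^k}` of order `2 ^ k` (meant for `4 ≤ k`). -/
abbrev QuasidihedralGroup (k : ℕ) : Type :=
  PresentedGroup (quasidihedralRels k)

/-- The quasidihedral group of order `16`:
`⟨a, x | a ^ 8 = x ^ 2 = 1, x a x = a ^ 3⟩`. -/
abbrev QD16 : Type := QuasidihedralGroup 4

/-- The subgroup `1 + J(A)` of the unit group of a ring `A`, where `J(A)` is the Jacobson
radical. -/
def oneAddJacobson (A : Type*) [Ring A] : Subgroup Aˣ where
  carrier := {u | (u : A) - 1 ∈ Ring.jacobson A}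
  one_mem' := by simp
  mul_mem' := by
    intro u v hu hv
    have h : ((u * v : Aˣ) : A) - 1 = (u : A) * ((v : A) - 1) + ((u : A) - 1) := by
      rw [Units.val_mul]; noncomm_ring
    show ((u * v : Aˣ) : A) - 1 ∈ Ring.jacobson A
    rw [h]
    exact add_mem (Ideal.mul_mem_left _ _ hv) hu
  inv_mem' := by
    intro u hu
    have h : ((u⁻¹ : Aˣ) : A) - 1 = -(((u⁻¹ : Aˣ) : A) * ((u : A) - 1)) := by
      rw [mul_sub, Units.inv_mul]; noncomm_ring
    show ((u⁻¹ : Aˣ) : A) - 1 ∈ Ring.jacobson A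
    rw [h]
    exact neg_mem (Ideal.mul_mem_left _ _ hu)

instance oneAddJacobson_normal (A : Type*) [Ring A] : (oneAddJacobson A).Normal where
  conj_mem := by
    intro u hu g
    have h : ((g * u * g⁻¹ : Aˣ) : A) - 1 = (g : A) * (((u : A) - 1) * ((g⁻¹ : Aˣ) : A)) := by
      rw [sub_mul, mul_sub, one_mul, Units.mul_inv, Units.val_mul, Units.val_mul, mul_assoc]
    show ((g * u * g⁻¹ : Aˣ) : A) - 1 ∈ Ring.jacobson A
    rw [h]
    exact Ideal.mul_mem_left _ _ (Ideal.mul_mem_right _ _ hu)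

/-- Every element of the set `1 + J(A)` is a unit, so the subgroup `oneAddJacobson A` is all of
`1 + J(A)`. -/
theorem coe_image_oneAddJacobson (A : Type*) [Ring A] :
    (fun u : Aˣ => (u : A)) '' (oneAddJacobson A : Set Aˣ) =
      {a : A | ∃ j ∈ Ring.jacobson A, a = 1 + j} := by
  have key : ∀ j ∈ Ring.jacobson A, ∃ y : A, y * (1 + j) = 1 := by
    intro j hj
    have hj' : j ∈ Ideal.jacobson (⊥ : Ideal A) := by
      rwa [Ideal.jacobson_bot]
    obtain ⟨y, hy⟩ := Ideal.mem_jacobson_iff.1 hj' 1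
    refine ⟨y, ?_⟩
    have h0 := (Submodule.mem_bot A).1 hy
    have : y * (1 + j) = (y * 1 * j + y - 1) + 1 := by noncomm_ring
    rw [this, h0, zero_add]
  ext a
  constructor
  · rintro ⟨u, hu, rfl⟩
    exact ⟨(u : A) - 1, hu, by simp⟩
  · rintro ⟨j, hj, rfl⟩
    obtain ⟨y, hy⟩ := key j hj
    have hy1 : y = 1 + -(y * j) := by
      rw [← hy]; noncomm_ring
    obtain ⟨z, hz⟩ := key (-(y * j)) (neg_mem (Ideal.mul_mem_left _ _ hj))
    rw [← hy1] at hz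
    have hzj : z = 1 + j := by
      calc z = z * (y * (1 + j)) := by rw [hy, mul_one]
        _ = 1 + j := by rw [← mul_assoc, hz, one_mul]
    refine ⟨⟨1 + j, y, by rw [← hzj]; exact hz, hy⟩, ?_, rfl⟩
    show (1 + j) - 1 ∈ Ring.jacobson A
    simpa using hj

/-- A group `G` is centrally metabelian if its second derived subgroup is central. -/
def IsCentrallyMetabelian (G : Type*) [Group G] : Prop :=
  derivedSeries G 2 ≤ Subgroup.center G

namespace QD16

/-- The generator `a` of order `8`. -/
def a : QD16 := PresentedGroup.of 0

/-- The generator `x` of order `2`. -/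
def x : QD16 := PresentedGroup.of 1

theorem a_pow_eight : a ^ 8 = 1 :=
  PresentedGroup.one_of_mem (rels := quasidihedralRels 4) (x := FreeGroup.of 0 ^ 8)
    (by simp [quasidihedralRels])

theorem x_sq : x ^ 2 = 1 :=
  PresentedGroup.one_of_mem (rels := quasidihedralRels 4) (x := FreeGroup.of 1 ^ 2)
    (by simp [quasidihedralRels])

theorem x_mul_a_mul_x : x * a * x = a ^ 3 :=
  PresentedGroup.mk_eq_mk_of_mul_inv_mem (rels := quasidihedralRels 4)
    (x := FreeGroup.of 1 * FreeGroup.of 0 * FreeGroup.of 1) (y := FreeGroup.of 0 ^ 3)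
    (by simp [quasidihedralRels])

theorem x_mul_x : x * x = 1 := by rw [← sq, x_sq]

theorem x_mul_a : x * a = a ^ 3 * x := by
  rw [← x_mul_a_mul_x, mul_assoc _ x x, x_mul_x, mul_one]

theorem x_mul_a_pow (i : ℕ) : x * a ^ i = a ^ (3 * i) * x := by
  induction i with
  | zero => simp
  | succ i ih =>
    rw [pow_succ, ← mul_assoc, ih, mul_assoc, x_mul_a, ← mul_assoc, ← pow_add]
    ring_nf

/-- The homomorphism out of `QD16` determined by images of the generators. -/
def lift {G : Type*} [Group G] (b y : G) (hb : b ^ 8 = 1) (hy : y ^ 2 = 1)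
    (hyb : y * b * y = b ^ 3) : QD16 →* G :=
  PresentedGroup.toGroup (f := ![b, y]) (by
    rintro r (rfl | rfl | rfl) <;> simp [hb, hy, hyb])

section lift

variable {G : Type*} [Group G] (b y : G) (hb : b ^ 8 = 1) (hy : y ^ 2 = 1)
  (hyb : y * b * y = b ^ 3)

@[simp] theorem lift_a : lift b y hb hy hyb a = b := PresentedGroup.toGroup.of _

@[simp] theorem lift_x : lift b y hb hy hyb x = y := PresentedGroup.toGroup.of _

end lift

/-- The homomorphism from `QD16` to a monoid determined by images of the generators. -/
def liftMonoid {M : Type*} [Monoid M] (b y : M) (hb : b ^ 8 = 1) (hy : y ^ 2 = 1)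
    (hyb : y * b * y = b ^ 3) : QD16 →* M :=
  (Units.coeHom M).comp (lift (Units.ofPowEqOne b 8 hb (by norm_num))
    (Units.ofPowEqOne y 2 hy (by norm_num)) (by ext; simp) (by ext; simp)
    (by ext; simp [hyb]))

section liftMonoid

variable {M : Type*} [Monoid M] (b y : M) (hb : b ^ 8 = 1) (hy : y ^ 2 = 1)
  (hyb : y * b * y = b ^ 3)

@[simp] theorem liftMonoid_a : liftMonoid b y hb hy hyb a = b := by
  simp [liftMonoid]

@[simp] theorem liftMonoid_x : liftMonoid b y hb hy hyb x = y := by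
  simp [liftMonoid]

end liftMonoid

theorem induction_mul {C : QD16 → Prop} (one : C 1) (mul_a : ∀ g, C g → C (a * g))
    (mul_x : ∀ g, C g → C (x * g)) (g : QD16) : C g := by
  have hpow : ∀ (i : ℕ) h, C h → C (a ^ i * h) := by
    intro i
    induction i with
    | zero => intro h hh; simpa using hh
    | succ i ih => intro h hh; rw [pow_succ', mul_assoc]; exact mul_a _ (ih h hh)
  let S : Subgroup QD16 :=
    { carrier := {g | (∀ h, C h → C (g * h)) ∧ ∀ h, C h → C (g⁻¹ * h)}
      one_mem' := by simp
      mul_mem' := by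
        rintro g g' ⟨h1, h2⟩ ⟨h3, h4⟩
        refine ⟨fun h hh => ?_, fun h hh => ?_⟩
        · rw [mul_assoc]; exact h1 _ (h3 _ hh)
        · rw [mul_inv_rev, mul_assoc]; exact h4 _ (h2 _ hh)
      inv_mem' := by
        rintro g ⟨h1, h2⟩
        exact ⟨h2, by simpa using h1⟩ }
  have hS : ∀ g, g ∈ S := by
    refine PresentedGroup.generated_by (quasidihedralRels 4) S ?_
    intro j
    fin_cases j
    · refine ⟨mul_a, fun h hh => ?_⟩
      have : a⁻¹ = a ^ 7 := inv_eq_of_mul_eq_one_right (by rw [← pow_succ', a_pow_eight])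
      change C (a⁻¹ * h)
      rw [this]; exact hpow 7 h hh
    · refine ⟨mul_x, fun h hh => ?_⟩
      change C (x⁻¹ * h)
      rw [inv_eq_of_mul_eq_one_right x_mul_x]; exact mul_x h hh
  simpa using (hS g).1 1 one

theorem exists_eq_pow (g : QD16) : ∃ i : Fin 8, ∃ j : Fin 2, g = a ^ (i : ℕ) * x ^ (j : ℕ) := by
  suffices h : ∃ i j : ℕ, g = a ^ i * x ^ j by
    obtain ⟨i, j, rfl⟩ := h
    refine ⟨⟨i % 8, Nat.mod_lt _ (by norm_num)⟩, ⟨j % 2, Nat.mod_lt _ (by norm_num)⟩, ?_⟩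
    simp only
    rw [← pow_eq_pow_mod i a_pow_eight, ← pow_eq_pow_mod j x_sq]
  induction g using induction_mul with
  | one => exact ⟨0, 0, by simp⟩
  | mul_a g ih =>
    obtain ⟨i, j, rfl⟩ := ih
    exact ⟨i + 1, j, by rw [← mul_assoc, ← pow_succ']⟩
  | mul_x g ih =>
    obtain ⟨i, j, rfl⟩ := ih
    exact ⟨3 * i, j + 1, by rw [← mul_assoc, x_mul_a_pow, mul_assoc, ← pow_succ']⟩

/-- The action of `QD16` on `ℤ/8` by the affine maps `i ↦ i + 1` and `i ↦ 3 * i`. -/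
def toPerm : QD16 →* Equiv.Perm (ZMod 8) :=
  lift ⟨fun i => i + 1, fun i => i - 1, by decide, by decide⟩
    ⟨fun i => 3 * i, fun i => 3 * i, by decide, by decide⟩ (by decide) (by decide) (by decide)

/-- The normal form `a ^ i * x ^ j`. -/
def normalForm (ij : Fin 8 × Fin 2) : QD16 := a ^ (ij.1 : ℕ) * x ^ (ij.2 : ℕ)

theorem normalForm_injective : Function.Injective normalForm := by
  have h : Function.Injective fun ij => (toPerm (normalForm ij) 0, toPerm (normalForm ij) 1) := by
    simp only [normalForm, toPerm, map_mul, map_pow, lift_a, lift_x]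
    decide
  intro s t hst
  exact h (by simp only [hst])

/-- The bijection between exponents of normal forms and elements of `QD16`. -/
noncomputable def equivFin : Fin 8 × Fin 2 ≃ QD16 :=
  Equiv.ofBijective normalForm ⟨normalForm_injective, fun g => by
    obtain ⟨i, j, h⟩ := exists_eq_pow g
    exact ⟨(i, j), h.symm⟩⟩

theorem equivFin_apply (ij : Fin 8 × Fin 2) : equivFin ij = a ^ (ij.1 : ℕ) * x ^ (ij.2 : ℕ) := rfl

noncomputable instance : Fintype QD16 := Fintype.ofEquiv _ equivFin

theorem card_eq : Fintype.card QD16 = 16 := by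
  rw [← Fintype.card_congr equivFin]; rfl

end QD16

namespace QD16

open Polynomial

variable (F : Type*) [Field F]

/-- The generator `a` as an element of the group algebra. -/
noncomputable def algA : MonoidAlgebra F QD16 := MonoidAlgebra.of F QD16 a

/-- The generator `x` as an element of the group algebra. -/
noncomputable def algX : MonoidAlgebra F QD16 := MonoidAlgebra.of F QD16 x

theorem algA_pow_eight : algA F ^ 8 = 1 := by
  rw [algA, ← map_pow, a_pow_eight, map_one]

theorem algX_mul_algX : algX F * algX F = 1 := by
  rw [algX, ← map_mul, x_mul_x, map_one]

theorem algX_mul_algA : algX F * algA F = algA F ^ 3 * algX F := by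
  rw [algX, algA, ← map_mul, ← map_pow, ← map_mul, x_mul_a]

theorem of_eq (i : Fin 8) (j : Fin 2) :
    MonoidAlgebra.of F QD16 (equivFin (i, j)) = algA F ^ (i : ℕ) * algX F ^ (j : ℕ) := by
  rw [equivFin_apply, algA, algX, ← map_pow, ← map_pow, ← map_mul]

variable {F}

theorem induction_gen {C : MonoidAlgebra F QD16 → Prop} (one : C 1)
    (mul_a : ∀ r, C r → C (algA F * r)) (mul_x : ∀ r, C r → C (algX F * r))
    (add : ∀ r s, C r → C s → C (r + s)) (smul : ∀ (c : F) r, C r → C (c • r))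
    (r : MonoidAlgebra F QD16) : C r := by
  induction r using MonoidAlgebra.induction_on with
  | of g =>
    induction g using induction_mul with
    | one => rw [map_one]; exact one
    | mul_a g ih => rw [map_mul]; exact mul_a _ ih
    | mul_x g ih => rw [map_mul]; exact mul_x _ ih
  | add r s hr hs => exact add r s hr hs
  | smul c r hr => exact smul c r hr

theorem eq_sum (r : MonoidAlgebra F QD16) :
    r = ∑ ij : Fin 8 × Fin 2, r.coeff (equivFin ij) • (algA F ^ (ij.1 : ℕ) * algX F ^ (ij.2 : ℕ)) := by
  classical
  ext g
  simp only [← of_eq, Prod.mk.eta]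
  obtain ⟨kl, rfl⟩ := equivFin.surjective g
  simp only [MonoidAlgebra.coeff_sum, MonoidAlgebra.of_apply, MonoidAlgebra.smul_single, smul_eq_mul,
    mul_one, MonoidAlgebra.coeff_single, Finsupp.finsetSum_apply, Finsupp.single_apply,
    EmbeddingLike.apply_eq_iff_eq, Finset.sum_ite_eq', Finset.mem_univ, if_true]

theorem algX_mul_aeval (P : F[X]) :
    algX F * aeval (algA F) P = aeval (algA F ^ 3) P * algX F := by
  induction P using Polynomial.induction_on' with
  | add p q hp hq => simp only [map_add, mul_add, add_mul, hp, hq]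
  | monomial n c =>
    simp only [aeval_monomial, ← Algebra.smul_def, mul_smul_comm, smul_mul_assoc]
    congr 1
    induction n with
    | zero => simp
    | succ n ih =>
      rw [pow_succ, ← mul_assoc, ih, mul_assoc, algX_mul_algA, ← mul_assoc, ← pow_succ]

theorem exists_eq_aeval (r : MonoidAlgebra F QD16) :
    ∃ P Q : F[X], r = aeval (algA F) P + aeval (algA F) Q * algX F := by
  induction r using induction_gen with
  | one => exact ⟨1, 0, by simp⟩
  | mul_a r ih =>
    obtain ⟨P, Q, rfl⟩ := ih
    exact ⟨X * P, X * Q, by simp [mul_add, mul_assoc]⟩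
  | mul_x r ih =>
    obtain ⟨P, Q, rfl⟩ := ih
    refine ⟨expand F 3 Q, expand F 3 P, ?_⟩
    rw [mul_add, ← mul_assoc, algX_mul_aeval, algX_mul_aeval, mul_assoc _ _ (algX F), algX_mul_algX,
      expand_aeval, expand_aeval, mul_one, add_comm]
  | add r s hr hs =>
    obtain ⟨P, Q, rfl⟩ := hr
    obtain ⟨P', Q', rfl⟩ := hs
    exact ⟨P + P', Q + Q', by simp only [map_add, add_mul]; abel⟩
  | smul c r ih =>
    obtain ⟨P, Q, rfl⟩ := ih
    exact ⟨c • P, c • Q, by simp only [map_smul, smul_add, smul_mul_assoc]⟩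

variable (F) in
/-- The augmentation map of the group algebra. -/
noncomputable def aug : MonoidAlgebra F QD16 →ₐ[F] F := MonoidAlgebra.lift F F QD16 1

@[simp] theorem aug_algA : aug F (algA F) = 1 := by simp [aug, algA]

@[simp] theorem aug_algX : aug F (algX F) = 1 := by simp [aug, algX]

theorem aug_surjective : Function.Surjective (aug F) := fun c =>
  ⟨algebraMap F _ c, AlgHom.commutes _ c⟩

section CharTwo

variable [CharP F 2]

instance charP_monoidAlgebra : CharP (MonoidAlgebra F QD16) 2 :=
  charP_of_injective_algebraMap (algebraMap F (MonoidAlgebra F QD16)).injective 2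

theorem aeval_pow_two_pow {A : Type*} [Semiring A] [Algebra F A] (b : A) (P : F[X]) (k : ℕ) :
    aeval b P ^ 2 ^ k = aeval (b ^ 2 ^ k) (P.map (iterateFrobenius F 2 k)) := by
  rw [← map_pow, ← map_iterateFrobenius_expand, map_expand, expand_aeval]

theorem pow_eight (r : MonoidAlgebra F QD16) : r ^ 8 = algebraMap F _ (aug F r ^ 8) := by
  obtain ⟨P, Q, rfl⟩ := exists_eq_aeval r
  set α := aeval (algA F) P with hα
  set β := aeval (algA F) Q with hβ
  set α' := aeval (algA F ^ 3) P with hα'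
  set β' := aeval (algA F ^ 3) Q with hβ'
  have h9 : (algA F ^ 3) ^ 3 = algA F := by
    rw [← pow_mul, show 3 * 3 = 8 + 1 by norm_num, pow_add, algA_pow_eight, one_mul, pow_one]
  have h12 : (algA F ^ 3) ^ 4 = algA F ^ 4 := by
    rw [← pow_mul, show 3 * 4 = 8 + 4 by norm_num, pow_add, algA_pow_eight, one_mul]
  have comm : ∀ R S : F[X], Commute (aeval (algA F) R) (aeval (algA F) S) := fun R S => by
    rw [Commute, SemiconjBy, ← map_mul, mul_comm, map_mul]
  have eα' : α' = aeval (algA F) (expand F 3 P) := by rw [expand_aeval]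
  have eβ' : β' = aeval (algA F) (expand F 3 Q) := by rw [expand_aeval]
  have cαβ : Commute α β := comm _ _
  have cαα' : Commute α α' := by rw [eα']; exact comm _ _
  have cαβ' : Commute α β' := by rw [eβ']; exact comm _ _
  have cβα' : Commute β α' := by rw [eα']; exact comm _ _
  have cββ' : Commute β β' := by rw [eβ']; exact comm _ _
  have cα'β' : Commute α' β' := by rw [eα', eβ']; exact comm _ _
  have xα : algX F * α = α' * algX F := algX_mul_aeval P
  have xβ : algX F * β = β' * algX F := algX_mul_aeval Q
  have xα' : algX F * α' = α * algX F := by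
    rw [eα', algX_mul_aeval, expand_aeval, h9]
  have xβ' : algX F * β' = β * algX F := by
    rw [eβ', algX_mul_aeval, expand_aeval, h9]
  have pow4 : ∀ (b : MonoidAlgebra F QD16) (R : F[X]),
      aeval b R ^ 4 = aeval (b ^ 4) (R.map (iterateFrobenius F 2 2)) :=
    fun b R => aeval_pow_two_pow b R 2
  have α4 : α' ^ 4 = α ^ 4 := by rw [hα, hα', pow4, pow4, h12]
  have β4 : β' ^ 4 = β ^ 4 := by rw [hβ, hβ', pow4, pow4, h12]
  have add4 : ∀ r s : MonoidAlgebra F QD16, Commute r s → (r + s) ^ 4 = r ^ 4 + s ^ 4 :=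
    fun r s h => add_pow_char_pow_of_commute 2 2 h
  have α8 : ∀ R : F[X], aeval (algA F) R ^ 8 = algebraMap F _ (aug F (aeval (algA F) R) ^ 8) := by
    intro R
    have h := aeval_pow_two_pow (algA F) R 3
    have h' := aeval_pow_two_pow (1 : F) R 3
    norm_num only [one_pow] at h h'
    rw [h, algA_pow_eight, ← aeval_algHom_apply, aug_algA, h', ← aeval_algebraMap_apply, map_one]
  have trace4 : (α + α') ^ 4 = 0 := by
    rw [add4 _ _ cαα', α4, CharTwo.add_self_eq_zero]
  have norm4 : (α * α' + β * β') ^ 4 = algebraMap F _ (aug F (α + β * algX F) ^ 8) := by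
    rw [add4 _ _ ((cαβ.mul_right cαβ').mul_left (cβα'.symm.mul_right cα'β')), cαα'.mul_pow,
      cββ'.mul_pow, α4, β4, ← pow_add, ← pow_add, α8, α8, ← map_add]
    simp only [map_add, map_mul, aug_algX, mul_one]
    rw [show (8 : ℕ) = 2 ^ 3 by norm_num, add_pow_char_pow, map_add]
  have sq : (α + β * algX F) ^ 2 = (α + α') * (α + β * algX F) + (α * α' + β * β') := by
    have e1 : (α + β * algX F) ^ 2 =
        α * α + α * β * algX F + β * α' * algX F + β * β' := by
      calc _ = α * α + α * β * algX F + β * (algX F * α) + β * (algX F * β) * algX F := by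
            noncomm_ring
        _ = α * α + α * β * algX F + β * α' * algX F + β * β' * (algX F * algX F) := by
            rw [xα, xβ]; noncomm_ring
        _ = _ := by rw [algX_mul_algX, mul_one]
    rw [e1, cβα'.eq]
    have e2 : (α + α') * (α + β * algX F) + (α * α' + β * β') =
      α * α + α * β * algX F + α' * β * algX F + β * β' + (α' * α + α * α') := by noncomm_ring
    rw [e2, cαα'.eq, CharTwo.add_self_eq_zero, add_zero]
  have ct : Commute (α + α') (α + β * algX F) := by
    have h : Commute (α + α') (algX F) := by
      rw [Commute, SemiconjBy, mul_add, xα, xα', add_mul, add_comm]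
    exact Commute.add_right ((Commute.refl α).add_left cαα'.symm)
      ((cαβ.add_left cβα'.symm).mul_right h)
  have cd : Commute (α * α' + β * β') (α + β * algX F) := by
    have h : Commute (α * α' + β * β') (algX F) := by
      rw [Commute, SemiconjBy, mul_add, ← mul_assoc, ← mul_assoc, xα, xβ, mul_assoc, mul_assoc, xα',
        xβ', ← mul_assoc, ← mul_assoc, add_mul, cαα'.eq, cββ'.eq]
    refine Commute.add_right ?_ (Commute.mul_right ?_ h)
    · exact ((Commute.refl α).mul_left cαα'.symm).add_left (cαβ.symm.mul_left cαβ'.symm)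
    · exact (cαβ.mul_left cβα'.symm).add_left ((Commute.refl β).mul_left cββ'.symm)
  have ctd : Commute (α + α') (α * α' + β * β') := by
    have h1 : Commute (α + α') α := (Commute.refl α).add_left cαα'.symm
    have h2 : Commute (α + α') α' := cαα'.add_left (Commute.refl _)
    exact (h1.mul_right h2).add_right
      ((cαβ.add_left cβα'.symm).mul_right (cαβ'.add_left cα'β'))
  rw [show 8 = 2 * 4 by norm_num, pow_mul, sq, add4 _ _ (ctd.mul_left cd.symm), ct.mul_pow, trace4,
    zero_mul, zero_add, norm4]

end CharTwo

end QD16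

section NormalElement

variable {A : Type*} [Ring A] {z : A}

theorem pow_dvd_mul_pow_of_normal (hz : ∀ r : A, z ∣ r * z) (k : ℕ) (r : A) :
    z ^ k ∣ r * z ^ k := by
  induction k with
  | zero => simp
  | succ k ih =>
    obtain ⟨c, hc⟩ := ih
    rw [pow_succ, ← mul_assoc, hc, mul_assoc]
    exact mul_dvd_mul_left _ (hz c)

theorem pow_succ_dvd_commutator_pow (hz : ∀ r : A, z ∣ r * z)
    (hz2 : ∀ r : A, z ^ 2 ∣ z * r - r * z) (k : ℕ) (r : A) :
    z ^ (k + 1) ∣ z ^ k * r - r * z ^ k := by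
  induction k with
  | zero => simp
  | succ k ih =>
    rw [show z ^ (k + 1) * r - r * z ^ (k + 1) =
      z * (z ^ k * r - r * z ^ k) + (z * r - r * z) * z ^ k by rw [pow_succ']; noncomm_ring]
    refine dvd_add ?_ ?_
    · rw [pow_succ' z (k + 1)]; exact mul_dvd_mul_left _ ih
    · obtain ⟨c, hc⟩ := hz2 r
      rw [hc, mul_assoc, show k + 1 + 1 = 2 + k by ring, pow_add]
      exact mul_dvd_mul_left _ (pow_dvd_mul_pow_of_normal hz k c)

theorem pow_succ_dvd_commutator (hz : ∀ r : A, z ∣ r * z)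
    (hz2 : ∀ r : A, z ^ 2 ∣ z * r - r * z) (hc : ∀ r s : A, z ∣ r * s - s * r)
    {k : ℕ} {r : A} (hr : z ^ k ∣ r) (s : A) : z ^ (k + 1) ∣ r * s - s * r := by
  obtain ⟨c, rfl⟩ := hr
  rw [show z ^ k * c * s - s * (z ^ k * c) =
    z ^ k * (c * s - s * c) + (z ^ k * s - s * z ^ k) * c by noncomm_ring]
  refine dvd_add ?_ (Dvd.dvd.mul_right (pow_succ_dvd_commutator_pow hz hz2 k s) c)
  rw [pow_succ]
  exact mul_dvd_mul_left _ (hc c s)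

theorem pow_three_dvd_commutator (hz2 : ∀ r : A, z ^ 2 ∣ z * r - r * z)
    (hc : ∀ r s : A, z ∣ r * s - s * r) {r s : A} (hr : z ∣ r) (hs : z ∣ s) :
    z ^ 3 ∣ r * s - s * r := by
  obtain ⟨c, rfl⟩ := hr
  obtain ⟨d, rfl⟩ := hs
  rw [show z * c * (z * d) - z * d * (z * c) = z ^ 2 * (c * d - d * c) +
    (z * ((z * d - d * z) * c) - z * ((z * c - c * z) * d)) by noncomm_ring]
  refine dvd_add ?_ (dvd_sub ?_ ?_)
  · rw [pow_succ]; exact mul_dvd_mul_left _ (hc c d)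
  · rw [pow_succ']; exact mul_dvd_mul_left _ (Dvd.dvd.mul_right (hz2 d) c)
  · rw [pow_succ']; exact mul_dvd_mul_left _ (Dvd.dvd.mul_right (hz2 c) d)

/-- The units congruent to `1` modulo the right ideal generated by `z`. -/
def congruenceUnits (z : A) : Subgroup Aˣ where
  carrier := {u | z ∣ (u : A) - 1}
  one_mem' := by simp
  mul_mem' := by
    intro u v hu hv
    have h : ((u * v : Aˣ) : A) - 1 = ((u : A) - 1) * v + ((v : A) - 1) := by
      rw [Units.val_mul]; noncomm_ring
    simpa only [Set.mem_ofPred_eq, h] using dvd_add (Dvd.dvd.mul_right hu _) hv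
  inv_mem' := by
    intro u hu
    have h : ((u⁻¹ : Aˣ) : A) - 1 = -(((u : A) - 1) * ((u⁻¹ : Aˣ) : A)) := by
      rw [sub_mul, Units.mul_inv]; noncomm_ring
    simpa only [Set.mem_ofPred_eq, h, dvd_neg] using Dvd.dvd.mul_right hu _

theorem mem_congruenceUnits {u : Aˣ} : u ∈ congruenceUnits z ↔ z ∣ (u : A) - 1 := Iff.rfl

theorem congruenceUnits_zero : congruenceUnits (0 : A) = ⊥ := by
  ext u
  rw [mem_congruenceUnits, zero_dvd_iff, sub_eq_zero, Units.val_eq_one, Subgroup.mem_bot]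

open scoped commutatorElement in
theorem commutator_mem_congruenceUnits {u v : Aˣ} (h : z ∣ (u : A) * v - v * u) :
    ⁅u, v⁆ ∈ congruenceUnits z := by
  have e : ((⁅u, v⁆ : Aˣ) : A) - 1 = ((u : A) * v - v * u) * ((u⁻¹ * v⁻¹ : Aˣ) : A) := by
    rw [commutatorElement_def, sub_mul, ← Units.val_mul, ← Units.val_mul, ← Units.val_mul,
      ← Units.val_mul]
    congr 1
    · rw [mul_assoc]
    · rw [← Units.val_one]; congr 1; group
  rw [mem_congruenceUnits, e]
  exact Dvd.dvd.mul_right h _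

theorem lowerCentralSeries_le_congruenceUnits (hz : ∀ r : A, z ∣ r * z)
    (hz2 : ∀ r : A, z ^ 2 ∣ z * r - r * z) (hc : ∀ r s : A, z ∣ r * s - s * r) (k : ℕ) :
    (⊤ : Subgroup Aˣ).lowerCentralSeries k ≤ congruenceUnits (z ^ k) := by
  induction k with
  | zero => intro u _; simp [mem_congruenceUnits]
  | succ k ih =>
    rw [Subgroup.lowerCentralSeries_succ, Subgroup.commutator_le]
    intro u hu v _
    refine commutator_mem_congruenceUnits ?_
    have h := pow_succ_dvd_commutator hz hz2 hc (mem_congruenceUnits.1 (ih hu)) (v : A)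
    rwa [show ((u : A) - 1) * v - v * ((u : A) - 1) = (u : A) * v - v * u by noncomm_ring] at h

theorem derivedSeries_two_le_congruenceUnits (hz2 : ∀ r : A, z ^ 2 ∣ z * r - r * z)
    (hc : ∀ r s : A, z ∣ r * s - s * r) :
    derivedSeries Aˣ 2 ≤ congruenceUnits (z ^ 3) := by
  have h1 : derivedSeries Aˣ 1 ≤ congruenceUnits z := by
    rw [derivedSeries_succ, Subgroup.commutator_le]
    exact fun u _ v _ => commutator_mem_congruenceUnits (hc _ _)
  rw [derivedSeries_succ, Subgroup.commutator_le]
  intro u hu v hv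
  refine commutator_mem_congruenceUnits ?_
  have h := pow_three_dvd_commutator hz2 hc (mem_congruenceUnits.1 (h1 hu))
    (mem_congruenceUnits.1 (h1 hv))
  rwa [show ((u : A) - 1) * ((v : A) - 1) - ((v : A) - 1) * ((u : A) - 1) =
    (u : A) * v - v * u by noncomm_ring] at h

theorem derivedSeries_two_le_center_units (hz : ∀ r : A, z ∣ r * z)
    (hz2 : ∀ r : A, z ^ 2 ∣ z * r - r * z) (hc : ∀ r s : A, z ∣ r * s - s * r)
    (hz4 : z ^ 4 = 0) : derivedSeries Aˣ 2 ≤ Subgroup.center Aˣ := by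
  intro u hu
  rw [Subgroup.mem_center_iff]
  intro v
  have h := pow_succ_dvd_commutator hz hz2 hc
    (mem_congruenceUnits.1 (derivedSeries_two_le_congruenceUnits hz2 hc hu)) (v : A)
  rw [hz4, zero_dvd_iff, sub_mul, mul_sub, one_mul, mul_one, sub_sub_sub_cancel_right,
    sub_eq_zero] at h
  exact Units.ext h.symm

end NormalElement

theorem derivedSeries_two_le_center_subgroup {G : Type*} [Group G]
    (h : derivedSeries G 2 ≤ Subgroup.center G) (H : Subgroup G) : IsCentrallyMetabelian H := by
  intro u hu
  rw [Subgroup.mem_center_iff]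
  intro v
  have := h (map_derivedSeries_le_derivedSeries H.subtype 2 (Subgroup.mem_map_of_mem _ hu))
  exact Subtype.ext (Subgroup.mem_center_iff.1 this v)

theorem nilpotencyClass_subgroup_eq_succ {G : Type*} [Group G] {H : Subgroup G} {n : ℕ}
    (h : H.lowerCentralSeries (n + 1) = ⊥) (h' : H.lowerCentralSeries n ≠ ⊥) :
    Group.IsNilpotent H ∧ Group.nilpotencyClass H = n + 1 := by
  have hnil : Group.IsNilpotent H := (Subgroup.isNilpotent_iff_lowerCentralSeries H).2 ⟨_, h⟩
  have key : ∀ k, Group.nilpotencyClass H ≤ k ↔ H.lowerCentralSeries k = ⊥ := by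
    intro k
    rw [← Subgroup.lowerCentralSeries_eq_bot_iff_nilpotencyClass_le,
      ← Subgroup.top_subtype_lowerCentralSeries H, Subgroup.map_eq_bot_iff_of_injective _
      H.subtype_injective]
  refine ⟨hnil, le_antisymm ((key _).2 h) ?_⟩
  by_contra! hlt
  exact h' ((key n).1 (by omega))

namespace QD16

variable {F : Type*} [Field F]

theorem eq_zero_of_sum_eq_zero (c : Fin 8 × Fin 2 → F)
    (h : ∑ ij, c ij • (algA F ^ (ij.1 : ℕ) * algX F ^ (ij.2 : ℕ)) = 0) (ij : Fin 8 × Fin 2) :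
    c ij = 0 := by
  classical
  have h' := congrArg (fun r => r.coeff (equivFin ij)) h
  simpa only [MonoidAlgebra.coeff_zero, Finsupp.zero_apply, ← of_eq, Prod.mk.eta, MonoidAlgebra.coeff_sum, MonoidAlgebra.of_apply,
    MonoidAlgebra.smul_single, smul_eq_mul, mul_one, MonoidAlgebra.coeff_single,
    Finsupp.finsetSum_apply, Finsupp.single_apply, EmbeddingLike.apply_eq_iff_eq,
    Finset.sum_ite_eq', Finset.mem_univ, if_true] using h'

open scoped commutatorElement

section CharTwo

variable [CharP F 2]

theorem algA_sq_add_one_pow_four : (algA F ^ 2 + 1) ^ 4 = 0 := by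
  have h := add_pow_char_pow_of_commute 2 2 (Commute.one_right (algA F ^ 2))
  norm_num only [← pow_mul] at h
  rw [h, algA_pow_eight, CharTwo.add_self_eq_zero]

theorem algX_mul_normal :
    algX F * (algA F ^ 2 + 1) = (algA F ^ 2 + 1) * ((algA F ^ 4 + algA F ^ 2 + 1) * algX F) := by
  have h : algX F * algA F ^ 2 = algA F ^ 6 * algX F := by
    rw [sq, ← mul_assoc, algX_mul_algA, mul_assoc, algX_mul_algA]; noncomm_ring
  have e : (algA F ^ 2 + 1) * (algA F ^ 4 + algA F ^ 2 + 1) = algA F ^ 6 + 1 := by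
    have : (algA F ^ 2 + 1) * (algA F ^ 4 + algA F ^ 2 + 1) =
        algA F ^ 6 + 1 + (algA F ^ 4 + algA F ^ 4) + (algA F ^ 2 + algA F ^ 2) := by noncomm_ring
    rw [this, CharTwo.add_self_eq_zero, CharTwo.add_self_eq_zero, add_zero, add_zero]
  rw [mul_add, h, ← mul_assoc, e, add_mul, one_mul, mul_one]

theorem normal_element (r : MonoidAlgebra F QD16) :
    algA F ^ 2 + 1 ∣ r * (algA F ^ 2 + 1) := by
  induction r using induction_gen with
  | one => simp
  | mul_a r ih =>
    obtain ⟨c, hc⟩ := ih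
    exact ⟨algA F * c, by rw [mul_assoc, hc]; noncomm_ring⟩
  | mul_x r ih =>
    obtain ⟨c, hc⟩ := ih
    exact ⟨_, by rw [mul_assoc, hc, ← mul_assoc, algX_mul_normal, mul_assoc]⟩
  | add r s hr hs => rw [add_mul]; exact dvd_add hr hs
  | smul c r ih =>
    obtain ⟨d, hd⟩ := ih
    exact ⟨c • d, by rw [smul_mul_assoc, hd, mul_smul_comm]⟩

theorem normal_sq_dvd (r : MonoidAlgebra F QD16) :
    (algA F ^ 2 + 1) ^ 2 ∣ (algA F ^ 2 + 1) * r - r * (algA F ^ 2 + 1) := by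
  have n2 := pow_dvd_mul_pow_of_normal (normal_element (F := F)) 2
  have hx : (algA F ^ 2 + 1) ^ 2 ∣ (algA F ^ 2 + 1) * algX F - algX F * (algA F ^ 2 + 1) := by
    rw [algX_mul_normal]
    exact ⟨-algA F ^ 2 * algX F, by noncomm_ring⟩
  induction r using induction_gen with
  | one => simp
  | mul_a r ih =>
    obtain ⟨c, hc⟩ := ih
    exact ⟨algA F * c, by
      rw [show (algA F ^ 2 + 1) * (algA F * r) - algA F * r * (algA F ^ 2 + 1) =
        algA F * ((algA F ^ 2 + 1) * r - r * (algA F ^ 2 + 1)) by noncomm_ring, hc]; noncomm_ring⟩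
  | mul_x r ih =>
    rw [show (algA F ^ 2 + 1) * (algX F * r) - algX F * r * (algA F ^ 2 + 1) =
      ((algA F ^ 2 + 1) * algX F - algX F * (algA F ^ 2 + 1)) * r +
      algX F * ((algA F ^ 2 + 1) * r - r * (algA F ^ 2 + 1)) by noncomm_ring]
    refine dvd_add (Dvd.dvd.mul_right hx r) ?_
    obtain ⟨c, hc⟩ := ih
    rw [hc, ← mul_assoc]
    exact Dvd.dvd.mul_right (n2 _) c
  | add r s hr hs =>
    rw [mul_add _ r s, add_mul r s, add_sub_add_comm]; exact dvd_add hr hs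
  | smul c r ih =>
    obtain ⟨d, hd⟩ := ih
    exact ⟨c • d, by rw [smul_mul_assoc, mul_smul_comm, ← smul_sub, hd, mul_smul_comm]⟩

theorem normal_dvd_commutator (r s : MonoidAlgebra F QD16) :
    algA F ^ 2 + 1 ∣ r * s - s * r := by
  have key : ∀ s : MonoidAlgebra F QD16, algA F ^ 2 + 1 ∣ algA F * s - s * algA F →
      algA F ^ 2 + 1 ∣ algX F * s - s * algX F → ∀ r, algA F ^ 2 + 1 ∣ r * s - s * r := by
    intro s ha hx r
    have step : ∀ b r : MonoidAlgebra F QD16, algA F ^ 2 + 1 ∣ b * s - s * b →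
        algA F ^ 2 + 1 ∣ r * s - s * r → algA F ^ 2 + 1 ∣ b * r * s - s * (b * r) := by
      intro b r hb hr
      rw [show b * r * s - s * (b * r) = (b * s - s * b) * r + b * (r * s - s * r) by noncomm_ring]
      refine dvd_add (Dvd.dvd.mul_right hb r) ?_
      obtain ⟨c, hc⟩ := hr
      rw [hc, ← mul_assoc]
      exact Dvd.dvd.mul_right (normal_element _) c
    induction r using induction_gen with
    | one => simp
    | mul_a r ih => exact step _ _ ha ih
    | mul_x r ih => exact step _ _ hx ih
    | add r t hr ht => rw [mul_add, add_mul, add_sub_add_comm]; exact dvd_add hr ht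
    | smul c r ih =>
      obtain ⟨d, hd⟩ := ih
      exact ⟨c • d, by rw [smul_mul_assoc, mul_smul_comm, ← smul_sub, hd, mul_smul_comm]⟩
  have hax : algA F ^ 2 + 1 ∣ algA F * algX F - algX F * algA F := by
    rw [algX_mul_algA]
    refine ⟨algA F * algX F, ?_⟩
    rw [sub_eq_iff_eq_add]
    have : (algA F ^ 2 + 1) * (algA F * algX F) + algA F ^ 3 * algX F =
      algA F * algX F + (algA F ^ 3 * algX F + algA F ^ 3 * algX F) := by noncomm_ring
    rw [this, CharTwo.add_self_eq_zero, add_zero]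
  have hxa : algA F ^ 2 + 1 ∣ algX F * algA F - algA F * algX F := by
    rw [← neg_sub, dvd_neg]; exact hax
  refine key s ?_ ?_ r
  · rw [← neg_sub, dvd_neg]
    exact key _ (by simp) hxa s
  · rw [← neg_sub, dvd_neg]
    exact key _ hax (by simp) s

theorem pow_eight_of_aug_eq_one {r : MonoidAlgebra F QD16} (h : aug F r = 1) : r ^ 8 = 1 := by
  rw [pow_eight, h, one_pow, map_one]

theorem isUnit_of_aug_ne_zero {r : MonoidAlgebra F QD16} (h : aug F r ≠ 0) : IsUnit r := by
  have : IsUnit (r ^ 8) := by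
    rw [pow_eight]; exact (isUnit_iff_ne_zero.2 (pow_ne_zero _ h)).map _
  exact (isUnit_pow_iff (by norm_num)).1 this

theorem mem_jacobson_iff (r : MonoidAlgebra F QD16) :
    r ∈ Ring.jacobson (MonoidAlgebra F QD16) ↔ aug F r = 0 := by
  rw [← Ideal.jacobson_bot]
  constructor
  · intro h
    by_contra h0
    have hu := isUnit_of_aug_ne_zero h0
    have := Ideal.eq_top_of_isUnit_mem _ h hu
    rw [Ideal.jacobson_eq_top_iff] at this
    exact bot_ne_top this
  · intro h
    rw [Ideal.mem_jacobson_iff]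
    intro y
    obtain ⟨u, hu⟩ := isUnit_of_aug_ne_zero (r := 1 + y * r) (by simp [h])
    refine ⟨((u⁻¹ : (MonoidAlgebra F QD16)ˣ) : MonoidAlgebra F QD16), ?_⟩
    rw [Ideal.mem_bot, mul_assoc, sub_eq_zero]
    conv_lhs => rw [add_comm, ← mul_one_add, ← hu, Units.inv_mul]

theorem mem_oneAddJacobson_iff (u : (MonoidAlgebra F QD16)ˣ) :
    u ∈ oneAddJacobson (MonoidAlgebra F QD16) ↔ aug F u = 1 := by
  change (u : MonoidAlgebra F QD16) - 1 ∈ Ring.jacobson (MonoidAlgebra F QD16) ↔ _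
  rw [mem_jacobson_iff, map_sub, map_one, sub_eq_zero]

theorem lowerCentralSeries_oneAddJacobson_four :
    (oneAddJacobson (MonoidAlgebra F QD16)).lowerCentralSeries 4 = ⊥ := by
  rw [eq_bot_iff, ← congruenceUnits_zero, ← algA_sq_add_one_pow_four (F := F)]
  exact (Subgroup.lowerCentralSeries_mono 4 le_top).trans
    (lowerCentralSeries_le_congruenceUnits normal_element normal_sq_dvd normal_dvd_commutator 4)

theorem isCentrallyMetabelian_oneAddJacobson :
    IsCentrallyMetabelian (oneAddJacobson (MonoidAlgebra F QD16)) :=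
  derivedSeries_two_le_center_subgroup (derivedSeries_two_le_center_units normal_element
    normal_sq_dvd normal_dvd_commutator algA_sq_add_one_pow_four) _

variable (F) in
/-- The unit of the group algebra given by `a`. -/
noncomputable def unitA : (MonoidAlgebra F QD16)ˣ :=
  Units.ofPowEqOne (algA F) 8 (algA_pow_eight F) (by norm_num)

variable (F) in
/-- The unit of the group algebra given by `x`. -/
noncomputable def unitX : (MonoidAlgebra F QD16)ˣ :=
  ⟨algX F, algX F, algX_mul_algX F, algX_mul_algX F⟩

variable (F) in
/-- The unit `1 + (1 + a) x` of the group algebra. -/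
noncomputable def unitV : (MonoidAlgebra F QD16)ˣ :=
  Units.ofPowEqOne (1 + (1 + algA F) * algX F) 8
    (pow_eight_of_aug_eq_one (by simp [CharTwo.add_self_eq_zero])) (by norm_num)

theorem unitA_mem : unitA F ∈ oneAddJacobson (MonoidAlgebra F QD16) :=
  (mem_oneAddJacobson_iff _).2 (by simp [unitA])

theorem unitX_mem : unitX F ∈ oneAddJacobson (MonoidAlgebra F QD16) :=
  (mem_oneAddJacobson_iff _).2 (by simp [unitX])

theorem unitV_mem : unitV F ∈ oneAddJacobson (MonoidAlgebra F QD16) :=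
  (mem_oneAddJacobson_iff _).2 (by simp [unitV, CharTwo.add_self_eq_zero])

omit [CharP F 2] in
theorem unitA_sq_eq_commutator : unitA F ^ 2 = ⁅unitX F, unitA F⁆ := by
  rw [commutatorElement_def, eq_mul_inv_iff_mul_eq, eq_mul_inv_iff_mul_eq]
  refine Units.ext ?_
  simp only [unitA, unitX, Units.val_mul, Units.val_pow_eq_pow_val, Units.val_ofPowEqOne]
  rw [algX_mul_algA]; noncomm_ring

omit [CharP F 2] in
theorem sum_pow_mul_algX_ne_zero :
    algX F + algA F * algX F + algA F ^ 2 * algX F + algA F ^ 3 * algX F + algA F ^ 4 * algX F +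
      algA F ^ 5 * algX F + algA F ^ 6 * algX F + algA F ^ 7 * algX F ≠ 0 := by
  intro h
  have := eq_zero_of_sum_eq_zero (F := F) (fun ij => if ij.2 = 1 then 1 else 0)
    (by simpa [Fintype.sum_prod_type, Fin.sum_univ_eight] using h) (0, 1)
  simp at this

theorem unitV_mul_unitA_mul_unitV :
    (1 + (1 + algA F) * algX F) * algA F * (1 + (1 + algA F) * algX F) * algA F ^ 2 +
      algA F ^ 2 * ((1 + (1 + algA F) * algX F) * algA F * (1 + (1 + algA F) * algX F)) =
    algX F + algA F * algX F + algA F ^ 2 * algX F + algA F ^ 3 * algX F + algA F ^ 4 * algX F +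
      algA F ^ 5 * algX F + algA F ^ 6 * algX F + algA F ^ 7 * algX F := by
  have xa : ∀ r, algX F * (algA F * r) = algA F * (algA F * (algA F * (algX F * r))) := fun r => by
    rw [← mul_assoc, algX_mul_algA]; noncomm_ring
  have xa' : algX F * algA F = algA F * (algA F * (algA F * algX F)) := by
    rw [algX_mul_algA]; noncomm_ring
  have a8 : ∀ r, algA F * (algA F * (algA F * (algA F * (algA F * (algA F * (algA F *
      (algA F * r))))))) = r := fun r => by
    calc _ = algA F ^ 8 * r := by noncomm_ring
      _ = r := by rw [algA_pow_eight, one_mul]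
  have two : ∀ r : MonoidAlgebra F QD16, (2 : ℤ) • r = 0 := fun r => by
    rw [two_zsmul, CharTwo.add_self_eq_zero]
  rw [← CharTwo.add_eq_zero]
  simp only [pow_succ, pow_zero, one_mul, mul_one, mul_add, add_mul, mul_assoc, xa, xa', a8,
    algX_mul_algX]
  abel_nf
  simp only [two, add_zero]

theorem lowerCentralSeries_oneAddJacobson_three_ne_bot :
    (oneAddJacobson (MonoidAlgebra F QD16)).lowerCentralSeries 3 ≠ ⊥ := by
  intro h
  have h1 : unitA F ^ 2 ∈ (oneAddJacobson (MonoidAlgebra F QD16)).lowerCentralSeries 1 := by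
    rw [unitA_sq_eq_commutator]
    exact Subgroup.commutator_mem_commutator unitX_mem unitA_mem
  have h2 := Subgroup.commutator_mem_commutator (Subgroup.commutator_mem_commutator h1
    (unitV_mem (F := F))) (unitA_mem (F := F))
  have h3 : ⁅⁅unitA F ^ 2, unitV F⁆, unitA F⁆ = 1 := by
    rw [← Subgroup.mem_bot, ← h]; exact h2
  have c1 : Commute ⁅unitA F ^ 2, unitV F⁆ (unitA F) := commutatorElement_eq_one_iff_commute.1 h3
  have c2 : Commute (unitV F * unitA F ^ 2 * (unitV F)⁻¹) (unitA F) := by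
    have e : unitV F * unitA F ^ 2 * (unitV F)⁻¹ =
        ((unitA F ^ 2)⁻¹ * ⁅unitA F ^ 2, unitV F⁆)⁻¹ := by
      rw [commutatorElement_def]; group
    rw [e]
    exact (((Commute.refl _).pow_left 2).inv_left.mul_left c1).inv_left
  have c3 : Commute (unitA F ^ 2) ((unitV F)⁻¹ * unitA F * unitV F) := by
    have := (Commute.conj_iff (unitV F)⁻¹).2 c2
    simpa [mul_assoc] using this
  have c4 : Commute (unitA F ^ 2) (unitV F ^ 2) := by
    have e : (1 + (1 + algA F) * algX F) ^ 2 = algA F + algA F ^ 3 + algA F ^ 4 := by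
      have h : (1 + (1 + algA F) * algX F) ^ 2 = 1 + 2 • ((1 + algA F) * algX F) +
          (1 + algA F) * (algX F * algX F + algX F * algA F * algX F) := by noncomm_ring
      rw [h, two_smul, CharTwo.add_self_eq_zero, add_zero, algX_mul_algA, mul_assoc,
        algX_mul_algX, mul_one, show 1 + (1 + algA F) * (1 + algA F ^ 3) =
          (1 + 1) + (algA F + algA F ^ 3 + algA F ^ 4) by noncomm_ring,
        CharTwo.add_self_eq_zero, zero_add]
    refine Units.ext ?_
    simp only [unitA, unitV, Units.val_mul, Units.val_pow_eq_pow_val, Units.val_ofPowEqOne, e]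
    noncomm_ring
  have c5 := c4.mul_right c3
  rw [show unitV F ^ 2 * ((unitV F)⁻¹ * unitA F * unitV F) = unitV F * unitA F * unitV F by
    group] at c5
  have c6 := congrArg Units.val c5.eq
  simp only [unitA, unitV, Units.val_mul, Units.val_pow_eq_pow_val, Units.val_ofPowEqOne] at c6
  refine sum_pow_mul_algX_ne_zero (F := F) ?_
  rw [← unitV_mul_unitA_mul_unitV, c6, CharTwo.add_self_eq_zero]

theorem exponent_oneAddJacobson :
    Monoid.exponent (oneAddJacobson (MonoidAlgebra F QD16)) = 8 := by
  have h8 : Monoid.exponent (oneAddJacobson (MonoidAlgebra F QD16)) ∣ 2 ^ 3 := by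
    rw [Monoid.exponent_dvd_iff_forall_pow_eq_one]
    rintro ⟨u, hu⟩
    refine Subtype.ext (Units.ext ?_)
    simpa using pow_eight_of_aug_eq_one ((mem_oneAddJacobson_iff u).1 hu)
  obtain ⟨k, hk, he⟩ := (Nat.dvd_prime_pow Nat.prime_two).1 h8
  rw [he]
  interval_cases k
  any_goals rfl
  all_goals
    exfalso
    have h4 : Monoid.exponent (oneAddJacobson (MonoidAlgebra F QD16)) ∣ 4 := by rw [he]; norm_num
    have := Monoid.exponent_dvd_iff_forall_pow_eq_one.1 h4 ⟨unitA F, unitA_mem⟩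
    have := congrArg Units.val (congrArg Subtype.val this)
    have h4' : algA F ^ 4 = 1 := by simpa [unitA] using this
    rw [algA, ← map_pow, ← map_one (MonoidAlgebra.of F QD16)] at h4'
    have := MonoidAlgebra.of_injective h4'
    have := normalForm_injective (a₁ := (4, 0)) (a₂ := (0, 0)) (by simpa [normalForm] using this)
    simp at this

end CharTwo

end QD16

section CyclicUnits

variable {F : Type*} [Field F]

theorem nonempty_units_mulEquiv_zmod {q : ℕ} [Finite F] (hF : Nat.card F = q) :
    Nonempty (Fˣ ≃* Multiplicative (ZMod (q - 1))) := by
  have h : Nat.card Fˣ = q - 1 := by rw [Nat.card_units, hF]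
  exact ⟨h ▸ (zmodCyclicMulEquiv (G := Fˣ) inferInstance).symm⟩

end CyclicUnits

namespace QD16

variable {F : Type*} [Field F]

theorem finrank_monoidAlgebra : Module.finrank F (MonoidAlgebra F QD16) = 16 := by
  rw [LinearEquiv.finrank_eq (MonoidAlgebra.coeffLinearEquiv F), Module.finrank_finsupp_self, card_eq]

section CharTwo

variable [CharP F 2]

theorem nonempty_quotient_mulEquiv :
    Nonempty ((MonoidAlgebra F QD16)ˣ ⧸ oneAddJacobson (MonoidAlgebra F QD16) ≃* Fˣ) := by
  let f : (MonoidAlgebra F QD16)ˣ →* Fˣ := Units.map (aug F : MonoidAlgebra F QD16 →* F)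
  have hf : Function.Surjective f := fun c => by
    refine ⟨Units.map (algebraMap F (MonoidAlgebra F QD16) : F →* _) c, Units.ext ?_⟩
    exact AlgHom.commutes (aug F) (c : F)
  have hk : f.ker = oneAddJacobson (MonoidAlgebra F QD16) := by
    ext u
    rw [MonoidHom.mem_ker, mem_oneAddJacobson_iff, Units.ext_iff]
    rfl
  exact ⟨(QuotientGroup.quotientMulEquivOfEq hk.symm).trans
    (QuotientGroup.quotientKerEquivOfSurjective f hf)⟩

theorem card_oneAddJacobson [Finite F] :
    Nat.card (oneAddJacobson (MonoidAlgebra F QD16)) = Nat.card F ^ 15 := by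
  let L := (aug F).toLinearMap
  let e : oneAddJacobson (MonoidAlgebra F QD16) ≃ L.ker :=
    { toFun := fun u => ⟨(u : (MonoidAlgebra F QD16)ˣ) - 1, by
        have := (mem_oneAddJacobson_iff _).1 u.2
        rw [LinearMap.mem_ker, AlgHom.toLinearMap_apply, map_sub, this, map_one, sub_self]⟩
      invFun := fun r =>
        have h : aug F (r + 1) = 1 := by
          have := LinearMap.mem_ker.1 r.2
          rw [AlgHom.toLinearMap_apply] at this
          rw [map_add, this, map_one, zero_add]
        ⟨Units.ofPowEqOne (r + 1) 8 (pow_eight_of_aug_eq_one h) (by norm_num),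
          (mem_oneAddJacobson_iff _).2 h⟩
      left_inv := fun u => Subtype.ext (Units.ext (sub_add_cancel _ _))
      right_inv := fun r => Subtype.ext (add_sub_cancel_right _ _) }
  have hfin : Module.Finite F (MonoidAlgebra F QD16) :=
    Module.finite_of_finrank_pos (by rw [finrank_monoidAlgebra]; norm_num)
  have hr := L.finrank_range_add_finrank_ker
  rw [LinearMap.range_eq_top.2 (aug_surjective (F := F)), finrank_top, Module.finrank_self,
    finrank_monoidAlgebra] at hr
  rw [Nat.card_congr e, Module.natCard_eq_pow_finrank (K := F), show Module.finrank F L.ker = 15 by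
    omega]

end CharTwo

section Representations

open Matrix

variable {R : Type*} [CommRing R] [Algebra F R]

/-- The algebra homomorphism determined by images of the generators. -/
noncomputable def liftAlg {B : Type*} [Ring B] [Algebra F B] (b y : B) (hb : b ^ 8 = 1)
    (hy : y ^ 2 = 1) (hyb : y * b * y = b ^ 3) : MonoidAlgebra F QD16 →ₐ[F] B :=
  MonoidAlgebra.lift F B QD16 (liftMonoid b y hb hy hyb)

section liftAlg

variable {B : Type*} [Ring B] [Algebra F B] (b y : B) (hb : b ^ 8 = 1)
    (hy : y ^ 2 = 1) (hyb : y * b * y = b ^ 3)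

@[simp] theorem liftAlg_algA : liftAlg b y hb hy hyb (algA F) = b := by
  rw [liftAlg, algA, MonoidAlgebra.lift_of, liftMonoid_a]

@[simp] theorem liftAlg_algX : liftAlg b y hb hy hyb (algX F) = y := by
  rw [liftAlg, algX, MonoidAlgebra.lift_of, liftMonoid_x]

end liftAlg

variable (F) in
/-- The one-dimensional representations, one for each choice of signs. -/
noncomputable def linearRep : Fin 4 → MonoidAlgebra F QD16 →ₐ[F] F :=
  ![liftAlg 1 1 (by norm_num) (by norm_num) (by norm_num),
    liftAlg 1 (-1) (by norm_num) (by norm_num) (by norm_num),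
    liftAlg (-1) 1 (by norm_num) (by norm_num) (by norm_num),
    liftAlg (-1) (-1) (by norm_num) (by norm_num) (by norm_num)]

variable (F) in
/-- The two-dimensional representation that factors through the dihedral group of order `8`. -/
noncomputable def dihedralRep : MonoidAlgebra F QD16 →ₐ[F] Matrix (Fin 2) (Fin 2) F :=
  liftAlg !![0, 1; -1, 0] !![0, 1; 1, 0]
    (by rw [show 8 = 2 * 2 * 2 by norm_num, pow_mul, pow_mul]; simp [sq, Matrix.one_fin_two])
    (by simp [sq, Matrix.one_fin_two]) (by simp [pow_succ])

theorem faithful_sq {s : R} (hs : s ^ 2 = -2) :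
    (!![0, 1; 1, s] : Matrix (Fin 2) (Fin 2) R) ^ 2 = !![1, s; s, -1] := by
  rw [sq, Matrix.mul_fin_two]
  ext i j; fin_cases i <;> fin_cases j <;> simp; linear_combination hs

theorem faithful_pow_four {s : R} (hs : s ^ 2 = -2) :
    (!![0, 1; 1, s] : Matrix (Fin 2) (Fin 2) R) ^ 4 = -1 := by
  rw [show 4 = 2 * 2 by norm_num, pow_mul, faithful_sq hs, sq, Matrix.mul_fin_two,
    Matrix.one_fin_two, Matrix.neg_of]
  ext i j; fin_cases i <;> fin_cases j <;> simp <;> linear_combination hs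

variable (F) in
/-- The faithful two-dimensional representation attached to a square root `s` of `-2`. -/
noncomputable def faithfulRep {s : R} (hs : s ^ 2 = -2) :
    MonoidAlgebra F QD16 →ₐ[F] Matrix (Fin 2) (Fin 2) R :=
  liftAlg !![0, 1; 1, s] !![1, s; 0, -1]
    (by rw [show 8 = 4 * 2 by norm_num, pow_mul, faithful_pow_four hs]; simp)
    (by simp [sq, Matrix.one_fin_two])
    (by
      rw [pow_succ, faithful_sq hs, Matrix.mul_fin_two, Matrix.mul_fin_two, Matrix.mul_fin_two]
      ext i j; fin_cases i <;> fin_cases j <;> simp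
      linear_combination -hs)

/-- The coefficient of `a ^ i * x ^ j` after reduction along `a ^ 4 = ε`. -/
noncomputable def foldCoeff (ε : F) (r : MonoidAlgebra F QD16) (i : Fin 4) (j : Fin 2) : F :=
  r.coeff (equivFin (⟨i, by omega⟩, j)) + ε * r.coeff (equivFin (⟨i + 4, by omega⟩, j))

theorem map_eq_foldCoeff {B : Type*} [Ring B] [Algebra F B] (φ : MonoidAlgebra F QD16 →ₐ[F] B)
    {ε : F} (h : φ (algA F) ^ 4 = algebraMap F B ε) (r : MonoidAlgebra F QD16) :
    φ r = foldCoeff ε r 0 0 • 1 + foldCoeff ε r 1 0 • φ (algA F) +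
      foldCoeff ε r 2 0 • φ (algA F) ^ 2 + foldCoeff ε r 3 0 • φ (algA F) ^ 3 +
      (foldCoeff ε r 0 1 • 1 + foldCoeff ε r 1 1 • φ (algA F) +
      foldCoeff ε r 2 1 • φ (algA F) ^ 2 + foldCoeff ε r 3 1 • φ (algA F) ^ 3) * φ (algX F) := by
  have hp : ∀ k, φ (algA F) ^ (k + 4) = ε • φ (algA F) ^ k := fun k => by
    rw [pow_add, h, ← Algebra.commutes, ← Algebra.smul_def]
  conv_lhs => rw [eq_sum r]
  simp only [Fintype.sum_prod_type, map_sum, Fin.sum_univ_two, map_add, map_smul, map_mul,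
    map_pow]
  rw [Fin.sum_univ_add (a := 4) (b := 4), ← Finset.sum_add_distrib]
  rw [Fin.sum_univ_four]
  simp only [Fin.val_castAdd, Fin.val_natAdd, add_comm 4, hp, foldCoeff]
  simp only [Fin.isValue, Fin.val_zero, Fin.val_one, Fin.val_two, pow_zero, pow_one, mul_one]
  simp [add_smul, mul_smul, add_mul, smul_comm ε]
  abel

theorem eq_zero_of_foldCoeff (h2 : (2 : F) ≠ 0) {r : MonoidAlgebra F QD16}
    (h : ∀ i j, foldCoeff 1 r i j = 0) (h' : ∀ i j, foldCoeff (-1) r i j = 0) : r = 0 := by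
  have key : ∀ (i : Fin 4) j, r.coeff (equivFin (⟨i, by omega⟩, j)) = 0 ∧
      r.coeff (equivFin (⟨i + 4, by omega⟩, j)) = 0 := by
    intro i j
    have e := h i j
    have e' := h' i j
    rw [foldCoeff] at e e'
    constructor <;> refine (mul_eq_zero.1 (?_ : (2 : F) * _ = 0)).resolve_left h2
    · linear_combination e + e'
    · linear_combination e - e'
  ext g
  obtain ⟨⟨i, j⟩, rfl⟩ := equivFin.surjective g
  rw [MonoidAlgebra.coeff_zero, Finsupp.zero_apply]
  by_cases hi : (i : ℕ) < 4
  · exact (key ⟨i, hi⟩ j).1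
  · have e : i = ⟨(i - 4) + 4, by omega⟩ := Fin.ext (by simp; omega)
    rw [e]
    exact (key ⟨i - 4, by omega⟩ j).2

theorem linearRep_eq_zero (h2 : (2 : F) ≠ 0) {r : MonoidAlgebra F QD16}
    (hr : ∀ k, linearRep F k r = 0) (j : Fin 2) :
    foldCoeff 1 r 0 j + foldCoeff 1 r 2 j = 0 ∧ foldCoeff 1 r 1 j + foldCoeff 1 r 3 j = 0 := by
  have h0 := hr 0
  have h1 := hr 1
  have h3 := hr 2
  have h4 := hr 3
  rw [map_eq_foldCoeff (ε := 1) _ (by simp [linearRep, show (-1 : F) ^ 4 = 1 by norm_num])] at h0 h1 h3 h4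
  simp only [linearRep, cons_val, liftAlg_algA, liftAlg_algX, smul_eq_mul] at h0 h1 h3 h4
  have h4' : (4 : F) ≠ 0 := by
    rw [show (4 : F) = 2 * 2 by norm_num]; exact mul_ne_zero h2 h2
  constructor <;> refine (mul_eq_zero.1 (?_ : (4 : F) * _ = 0)).resolve_left h4' <;>
    revert j <;> rw [Fin.forall_fin_two] <;> constructor
  · linear_combination h0 + h1 + h3 + h4
  · linear_combination h0 - h1 + h3 - h4
  · linear_combination h0 + h1 - h3 - h4
  · linear_combination h0 - h1 - h3 + h4

theorem dihedralRep_eq_zero (h2 : (2 : F) ≠ 0) {r : MonoidAlgebra F QD16}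
    (hr : dihedralRep F r = 0) (j : Fin 2) :
    foldCoeff 1 r 0 j - foldCoeff 1 r 2 j = 0 ∧ foldCoeff 1 r 1 j - foldCoeff 1 r 3 j = 0 := by
  have b2 : (!![0, 1; -1, 0] : Matrix (Fin 2) (Fin 2) F) ^ 2 = -1 := by
    simp [sq, Matrix.one_fin_two]
  have b3 : (!![0, 1; -1, 0] : Matrix (Fin 2) (Fin 2) F) ^ 3 = !![0, -1; 1, 0] := by
    rw [pow_succ, b2]; simp
  have b4 : (!![0, 1; -1, 0] : Matrix (Fin 2) (Fin 2) F) ^ 4 = 1 := by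
    rw [show 4 = 2 * 2 by norm_num, pow_mul, b2]; simp
  rw [map_eq_foldCoeff (ε := 1) _ (by simp [dihedralRep, b4])] at hr
  simp only [dihedralRep, liftAlg_algA, liftAlg_algX, b2, b3] at hr
  have h00 := congrFun₂ hr 0 0
  have h01 := congrFun₂ hr 0 1
  have h10 := congrFun₂ hr 1 0
  have h11 := congrFun₂ hr 1 1
  simp [Matrix.one_fin_two] at h00 h01 h10 h11
  constructor <;> refine (mul_eq_zero.1 (?_ : (2 : F) * _ = 0)).resolve_left h2 <;>
    revert j <;> rw [Fin.forall_fin_two] <;> constructor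
  · linear_combination h00 + h11
  · linear_combination h01 + h10
  · linear_combination h01 - h10
  · linear_combination h00 - h11

theorem foldCoeff_one_eq_zero (h2 : (2 : F) ≠ 0) {r : MonoidAlgebra F QD16}
    (hr : ∀ k, linearRep F k r = 0) (hr' : dihedralRep F r = 0) (i : Fin 4) (j : Fin 2) :
    foldCoeff 1 r i j = 0 := by
  obtain ⟨h1, h3⟩ := linearRep_eq_zero h2 hr j
  obtain ⟨h4, h5⟩ := dihedralRep_eq_zero h2 hr' j
  refine (mul_eq_zero.1 (?_ : (2 : F) * _ = 0)).resolve_left h2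
  fin_cases i <;> simp only [Fin.zero_eta, Fin.mk_one, Fin.reduceFinMk]
  · linear_combination h1 + h4
  · linear_combination h3 + h5
  · linear_combination h1 - h4
  · linear_combination h3 - h5

theorem faithfulRep_eq_zero {K : Type*} [Field K] [Algebra F K] (h2 : (2 : K) ≠ 0) {s : K}
    (hs : s ^ 2 = -2) {r : MonoidAlgebra F QD16} (hr : faithfulRep F hs r = 0) (j : Fin 2) :
    algebraMap F K (foldCoeff (-1) r 0 j + foldCoeff (-1) r 2 j) +
      s * algebraMap F K (foldCoeff (-1) r 3 j) = 0 ∧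
    algebraMap F K (foldCoeff (-1) r 1 j - foldCoeff (-1) r 3 j) +
      s * algebraMap F K (foldCoeff (-1) r 2 j) = 0 := by
  have b4 := faithful_pow_four hs
  rw [map_eq_foldCoeff (ε := -1) _ (by simp [faithfulRep, b4])] at hr
  have b3 : (!![0, 1; 1, s] : Matrix (Fin 2) (Fin 2) K) ^ 3 = !![s, -1; -1, 0] := by
    rw [pow_succ, faithful_sq hs]
    ext i j; fin_cases i <;> fin_cases j <;> simp; linear_combination hs
  simp only [faithfulRep, liftAlg_algA, liftAlg_algX, faithful_sq hs, b3] at hr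
  have h00 := congrFun₂ hr 0 0
  have h01 := congrFun₂ hr 0 1
  have h10 := congrFun₂ hr 1 0
  have h11 := congrFun₂ hr 1 1
  simp [Matrix.one_fin_two] at h00 h01 h10 h11
  simp only [Algebra.smul_def] at h00 h01 h10 h11
  simp only [map_add, map_sub]
  have h11' : algebraMap F K (foldCoeff (-1) r 0 0) + algebraMap F K (foldCoeff (-1) r 2 0) +
      s * algebraMap F K (foldCoeff (-1) r 3 0) + s * (algebraMap F K (foldCoeff (-1) r 1 0) -
      algebraMap F K (foldCoeff (-1) r 3 0) + s * algebraMap F K (foldCoeff (-1) r 2 0)) -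
      (algebraMap F K (foldCoeff (-1) r 0 1) + algebraMap F K (foldCoeff (-1) r 2 1) +
      s * algebraMap F K (foldCoeff (-1) r 3 1)) = 0 := by
    linear_combination h11 + hs * (algebraMap F K (foldCoeff (-1) r 2 0) -
      algebraMap F K (foldCoeff (-1) r 2 1))
  constructor <;> refine (mul_eq_zero.1 (?_ : (2 : K) * _ = 0)).resolve_left h2 <;>
    revert j <;> rw [Fin.forall_fin_two] <;> constructor
  · linear_combination 2 * (h00 + h11') - s * (h01 + h10) + s ^ 2 * h00 -
      (algebraMap F K (foldCoeff (-1) r 0 0) + algebraMap F K (foldCoeff (-1) r 2 0) +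
      s * algebraMap F K (foldCoeff (-1) r 3 0)) * hs
  · linear_combination 2 * h00 - (2 * (h00 + h11') - s * (h01 + h10) + s ^ 2 * h00 -
      (algebraMap F K (foldCoeff (-1) r 0 0) + algebraMap F K (foldCoeff (-1) r 2 0) +
      s * algebraMap F K (foldCoeff (-1) r 3 0)) * hs)
  · linear_combination 2 * (h01 + h10) - s * (h00 - h11') -
      (algebraMap F K (foldCoeff (-1) r 1 0) - algebraMap F K (foldCoeff (-1) r 3 0) +
      s * algebraMap F K (foldCoeff (-1) r 2 0)) * hs
  · linear_combination 2 * h10 - (2 * (h01 + h10) - s * (h00 - h11') -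
      (algebraMap F K (foldCoeff (-1) r 1 0) - algebraMap F K (foldCoeff (-1) r 3 0) +
      s * algebraMap F K (foldCoeff (-1) r 2 0)) * hs)

end Representations

end QD16

namespace QD16

open Matrix

variable {F : Type*} [Field F]

theorem nonempty_algEquiv_of_injective {B : Type*} [Ring B] [Algebra F B] [Module.Finite F B]
    (φ : MonoidAlgebra F QD16 →ₐ[F] B) (hφ : ∀ r, φ r = 0 → r = 0)
    (hB : Module.finrank F B = 16) : Nonempty (MonoidAlgebra F QD16 ≃ₐ[F] B) := by
  have hfin : Module.Finite F (MonoidAlgebra F QD16) :=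
    Module.finite_of_finrank_pos (by rw [finrank_monoidAlgebra]; norm_num)
  have hinj : Function.Injective φ := (injective_iff_map_eq_zero φ).2 hφ
  have hsurj : Function.Surjective φ :=
    (LinearMap.injective_iff_surjective_of_finrank_eq_finrank (f := φ.toLinearMap)
      (by rw [finrank_monoidAlgebra, hB])).1 hinj
  exact ⟨AlgEquiv.ofBijective φ ⟨hinj, hsurj⟩⟩

theorem nonempty_algEquiv_of_isSquare (h2 : (2 : F) ≠ 0) (h : IsSquare (-2 : F)) :
    Nonempty (MonoidAlgebra F QD16 ≃ₐ[F] (Fin 4 → F) × (Fin 3 → Matrix (Fin 2) (Fin 2) F)) := by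
  obtain ⟨s, hs⟩ := h
  have hs1 : s ^ 2 = -2 := by rw [hs, sq]
  have hs2 : (-s) ^ 2 = -2 := by rw [neg_sq, hs1]
  have hs0 : s ≠ 0 := by
    rintro rfl
    rw [zero_pow two_ne_zero, eq_comm, neg_eq_zero] at hs1
    exact h2 hs1
  refine nonempty_algEquiv_of_injective ((AlgHom.pi (linearRep F)).prod
    (AlgHom.pi ![dihedralRep F, faithfulRep F hs1, faithfulRep F hs2])) ?_ ?_
  · intro r hr
    have hl : ∀ k, linearRep F k r = 0 := fun k => congrFun (congrArg Prod.fst hr) k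
    have hd : dihedralRep F r = 0 := congrFun (congrArg Prod.snd hr) 0
    have hf : faithfulRep F hs1 r = 0 := congrFun (congrArg Prod.snd hr) 1
    have hf' : faithfulRep F hs2 r = 0 := congrFun (congrArg Prod.snd hr) 2
    refine eq_zero_of_foldCoeff h2 (foldCoeff_one_eq_zero h2 hl hd) fun i j => ?_
    obtain ⟨h1, h3⟩ := faithfulRep_eq_zero h2 hs1 hf j
    obtain ⟨h4, h5⟩ := faithfulRep_eq_zero h2 hs2 hf' j
    simp only [Algebra.algebraMap_self, RingHom.id_apply] at h1 h3 h4 h5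
    have hs' : 2 * s ≠ 0 := mul_ne_zero h2 hs0
    refine (mul_eq_zero.1 (?_ : 2 * s * _ = 0)).resolve_left hs'
    fin_cases i <;> simp only [Fin.zero_eta, Fin.mk_one, Fin.reduceFinMk]
    · linear_combination s * (h1 + h4) - h3 + h5
    · linear_combination s * (h3 + h5) + h1 - h4
    · linear_combination h3 - h5
    · linear_combination h1 - h4
  · rw [Module.finrank_prod, Module.finrank_pi, Module.finrank_pi_fintype]
    simp [Module.finrank_matrix]

theorem nonempty_algEquiv_of_not_isSquare (h2 : (2 : F) ≠ 0) (h : ¬ IsSquare (-2 : F))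
    {K : Type*} [Field K] [Algebra F K] (hK : Module.finrank F K = 2) (hsq : IsSquare (-2 : K)) :
    Nonempty (MonoidAlgebra F QD16 ≃ₐ[F]
      (Fin 4 → F) × Matrix (Fin 2) (Fin 2) F × Matrix (Fin 2) (Fin 2) K) := by
  obtain ⟨s, hs⟩ := hsq
  have hfin : Module.Finite F K := Module.finite_of_finrank_pos (by rw [hK]; norm_num)
  have hs1 : s ^ 2 = -2 := by rw [hs, sq]
  have h2K : (2 : K) ≠ 0 := by
    rw [← map_ofNat (algebraMap F K) 2, map_ne_zero]; exact h2
  have hind : ∀ u v : F, algebraMap F K u + s * algebraMap F K v = 0 → u = 0 ∧ v = 0 := by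
    intro u v huv
    by_cases hv : v = 0
    · subst hv
      simpa using huv
    · exfalso
      refine h ⟨u / v, (algebraMap F K).injective ?_⟩
      have hv' : algebraMap F K v ≠ 0 := by rwa [map_ne_zero]
      have hs' : s = -(algebraMap F K u / algebraMap F K v) := by
        rw [← neg_div, eq_div_iff hv']; linear_combination huv
      rw [map_mul, map_div₀, map_neg, map_ofNat, hs, hs']
      ring
  refine nonempty_algEquiv_of_injective ((AlgHom.pi (linearRep F)).prod
    ((dihedralRep F).prod (faithfulRep F hs1))) ?_ ?_
  · intro r hr
    have hl : ∀ k, linearRep F k r = 0 := fun k => congrFun (congrArg Prod.fst hr) k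
    have hd : dihedralRep F r = 0 := congrArg (fun t => t.2.1) hr
    have hf : faithfulRep F hs1 r = 0 := congrArg (fun t => t.2.2) hr
    refine eq_zero_of_foldCoeff h2 (foldCoeff_one_eq_zero h2 hl hd) fun i j => ?_
    obtain ⟨h1, h3⟩ := faithfulRep_eq_zero h2K hs1 hf j
    obtain ⟨h4, h5⟩ := hind _ _ h1
    obtain ⟨h6, h7⟩ := hind _ _ h3
    fin_cases i <;> simp only [Fin.zero_eta, Fin.mk_one, Fin.reduceFinMk]
    · linear_combination h4 - h7
    · linear_combination h6 + h5
    · exact h7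
    · exact h5
  · rw [Module.finrank_prod, Module.finrank_prod, Module.finrank_pi]
    simp [Module.finrank_matrix, hK]

end QD16

theorem FiniteField.two_ne_zero_of_card {F : Type*} [Field F] {p n : ℕ} (hp : p.Prime)
    (h2 : 2 < p) (hF : Nat.card F = p ^ n) : (2 : F) ≠ 0 := by
  have hfin : Finite F := Nat.finite_of_card_ne_zero (by rw [hF]; exact pow_ne_zero _ hp.ne_zero)
  have := Fintype.ofFinite F
  intro h
  have hc : ringChar F = 2 := CharP.ringChar_of_prime_eq_zero Nat.prime_two (by exact_mod_cast h)
  have he := FiniteField.even_card_iff_char_two.1 hc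
  rw [← Nat.card_eq_fintype_card, hF, ← Nat.dvd_iff_mod_eq_zero] at he
  have := (Nat.prime_dvd_prime_iff_eq Nat.prime_two hp).1 (Nat.prime_two.dvd_of_dvd_pow he)
  omega

theorem FiniteField.charP_two_of_card {F : Type*} [Field F] {n : ℕ} (hF : Nat.card F = 2 ^ n) :
    CharP F 2 := by
  have hfin : Finite F := Nat.finite_of_card_ne_zero (by rw [hF]; positivity)
  have := Fintype.ofFinite F
  have hn : n ≠ 0 := by
    rintro rfl
    have := Finite.one_lt_card (α := F)
    omega
  have he : Fintype.card F % 2 = 0 := by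
    rw [← Nat.card_eq_fintype_card, hF, ← Nat.dvd_iff_mod_eq_zero]
    exact dvd_pow_self 2 hn
  rw [← FiniteField.even_card_iff_char_two.2 he]
  infer_instance

theorem FiniteField.isSquare_neg_two_of_card_sq {K : Type*} [Field K] {q : ℕ}
    (hq : Odd q) (hK : Nat.card K = q ^ 2) : IsSquare (-2 : K) := by
  have hfin : Finite K := Nat.finite_of_card_ne_zero (by rw [hK]; exact pow_ne_zero _ hq.pos.ne')
  have := Fintype.ofFinite K
  have h : q ^ 2 % 8 = 1 := by
    have h8 : q % 8 = 1 ∨ q % 8 = 3 ∨ q % 8 = 5 ∨ q % 8 = 7 := by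
      have := Nat.odd_iff.1 hq
      omega
    rw [Nat.pow_mod]
    rcases h8 with h8 | h8 | h8 | h8 <;> rw [h8]
  rw [FiniteField.isSquare_neg_two_iff, ← Nat.card_eq_fintype_card, hK]
  omega

theorem FiniteField.finrank_eq_two_of_card {F K : Type*} [Field F] [Field K] [Algebra F K] {q : ℕ}
    (hF : Nat.card F = q) (hK : Nat.card K = q ^ 2) (hq : 1 < q) : Module.finrank F K = 2 := by
  have hfin : Finite K := Nat.finite_of_card_ne_zero (by rw [hK]; positivity)
  have hfin' : Module.Finite F K := Module.Finite.of_finite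
  have h := Module.natCard_eq_pow_finrank (K := F) (V := K)
  rw [hK, hF] at h
  exact (Nat.pow_right_injective hq h).symm

theorem FiniteField.nonempty_ringHom_of_card {F K : Type*} [Field F] [Field K] {q : ℕ}
    (hF : Nat.card F = q) (hK : Nat.card K = q ^ 2) (hq : 1 < q) : Nonempty (F →+* K) := by
  have hfin : Finite F := Nat.finite_of_card_ne_zero (by omega)
  have hfin' : Finite K := Nat.finite_of_card_ne_zero (by rw [hK]; positivity)
  obtain ⟨p, hp⟩ := CharP.exists F
  have hprime : Fact p.Prime := ⟨(CharP.char_is_prime_or_zero F p).resolve_right fun h0 => by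
    subst h0
    have := CharP.charP_to_charZero F
    exact not_finite F⟩
  have := Fintype.ofFinite K
  have := Fintype.ofFinite (FiniteField.Extension F p 2)
  have hcard : Fintype.card (FiniteField.Extension F p 2) = Fintype.card K := by
    rw [← Nat.card_eq_fintype_card, ← Nat.card_eq_fintype_card, FiniteField.natCard_extension, hF,
      hK]
  exact ⟨(FiniteField.ringEquivOfCardEq hcard).toRingHom.comp
    (algebraMap F (FiniteField.Extension F p 2))⟩

theorem nonempty_units_pi_mulEquiv_zmod {F : Type*} [Field F] {q : ℕ} [Finite F]
    (hF : Nat.card F = q) (k : ℕ) :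
    Nonempty ((Fin k → F)ˣ ≃* (Fin k → Multiplicative (ZMod (q - 1)))) := by
  obtain ⟨e⟩ := nonempty_units_mulEquiv_zmod hF
  exact ⟨MulEquiv.piUnits.trans (MulEquiv.piCongrRight fun _ => e)⟩

theorem theorem1 (F : Type*) [Field F] (p n q : ℕ) (hp : p.Prime) (hq : q = p ^ n)
    (hF : Nat.card F = q) :
    (p = 2 →
      Nonempty ((MonoidAlgebra F QD16)ˣ ⧸ oneAddJacobson (MonoidAlgebra F QD16) ≃*
        Multiplicative (ZMod (q - 1))) ∧
      IsPGroup 2 (oneAddJacobson (MonoidAlgebra F QD16)) ∧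
      Nat.card (oneAddJacobson (MonoidAlgebra F QD16)) = 2 ^ (15 * n) ∧
      Monoid.exponent (oneAddJacobson (MonoidAlgebra F QD16)) = 8 ∧
      Group.IsNilpotent (oneAddJacobson (MonoidAlgebra F QD16)) ∧
      Group.nilpotencyClass (oneAddJacobson (MonoidAlgebra F QD16)) = 4 ∧
      IsCentrallyMetabelian (oneAddJacobson (MonoidAlgebra F QD16))) ∧
    (2 < p →
      (((q : ℤ) ≡ 1 [ZMOD 8] ∨ (q : ℤ) ≡ 3 [ZMOD 8]) →
        Nonempty (MonoidAlgebra F QD16 ≃ₐ[F]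
          (Fin 4 → F) × (Fin 3 → Matrix (Fin 2) (Fin 2) F)) ∧
        Nonempty ((MonoidAlgebra F QD16)ˣ ≃*
          (Fin 4 → Multiplicative (ZMod (q - 1))) × (Fin 3 → GL (Fin 2) F))) ∧
      (((q : ℤ) ≡ -1 [ZMOD 8] ∨ (q : ℤ) ≡ -3 [ZMOD 8]) →
        (∀ (K : Type*) [Field K] [Algebra F K], Nat.card K = q ^ 2 →
          Nonempty (MonoidAlgebra F QD16 ≃ₐ[F]
            (Fin 4 → F) × Matrix (Fin 2) (Fin 2) F × Matrix (Fin 2) (Fin 2) K)) ∧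
        (∀ (K : Type*) [Field K], Nat.card K = q ^ 2 →
          Nonempty ((MonoidAlgebra F QD16)ˣ ≃*
            (Fin 4 → Multiplicative (ZMod (q - 1))) × GL (Fin 2) F × GL (Fin 2) K)))) := by
  have hfin : Finite F := Nat.finite_of_card_ne_zero (by
    rw [hF, hq]; exact pow_ne_zero _ hp.ne_zero)
  have hF' : Nat.card F = p ^ n := hF.trans hq
  have hq1 : 1 < q := hF ▸ Finite.one_lt_card
  refine ⟨?_, fun h2p => ?_⟩
  · rintro rfl
    have hchar : CharP F 2 := FiniteField.charP_two_of_card hF'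
    obtain ⟨e⟩ := QD16.nonempty_quotient_mulEquiv (F := F)
    obtain ⟨e'⟩ := nonempty_units_mulEquiv_zmod hF
    have hcard : Nat.card (oneAddJacobson (MonoidAlgebra F QD16)) = 2 ^ (15 * n) := by
      rw [QD16.card_oneAddJacobson, hF', ← pow_mul, mul_comm]
    obtain ⟨hnil, hclass⟩ := nilpotencyClass_subgroup_eq_succ
      (QD16.lowerCentralSeries_oneAddJacobson_four (F := F))
      QD16.lowerCentralSeries_oneAddJacobson_three_ne_bot
    exact ⟨⟨e.trans e'⟩, IsPGroup.of_card hcard, hcard, QD16.exponent_oneAddJacobson, hnil, hclass,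
      QD16.isCentrallyMetabelian_oneAddJacobson⟩
  · have h2 : (2 : F) ≠ 0 := FiniteField.two_ne_zero_of_card hp h2p hF'
    have hodd : Odd q := hq ▸ (hp.odd_of_ne_two h2p.ne').pow
    have hsq : IsSquare (-2 : F) ↔ q % 8 ≠ 5 ∧ q % 8 ≠ 7 := by
      have := Fintype.ofFinite F
      rw [FiniteField.isSquare_neg_two_iff, ← Nat.card_eq_fintype_card, hF]
    obtain ⟨u⟩ := nonempty_units_pi_mulEquiv_zmod hF 4
    refine ⟨fun h8 => ?_, fun h8 => ?_⟩
    · have hs : IsSquare (-2 : F) := hsq.2 (by simp only [Int.ModEq] at h8; omega)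
      obtain ⟨e⟩ := QD16.nonempty_algEquiv_of_isSquare h2 hs
      exact ⟨⟨e⟩, ⟨(Units.mapEquiv e.toMulEquiv).trans
        (MulEquiv.prodUnits.trans (u.prodCongr MulEquiv.piUnits))⟩⟩
    · have hs : ¬ IsSquare (-2 : F) := fun h => by
        have := hsq.1 h
        simp only [Int.ModEq] at h8
        omega
      refine ⟨fun K _ _ hK => ?_, fun K _ hK => ?_⟩
      · exact QD16.nonempty_algEquiv_of_not_isSquare h2 hs
          (FiniteField.finrank_eq_two_of_card hF hK hq1)
          (FiniteField.isSquare_neg_two_of_card_sq hodd hK)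
      · obtain ⟨f⟩ := FiniteField.nonempty_ringHom_of_card hF hK hq1
        have := f.toAlgebra
        obtain ⟨e⟩ := QD16.nonempty_algEquiv_of_not_isSquare h2 hs
          (FiniteField.finrank_eq_two_of_card hF hK hq1)
          (FiniteField.isSquare_neg_two_of_card_sq hodd hK)
        exact ⟨(Units.mapEquiv e.toMulEquiv).trans
          (MulEquiv.prodUnits.trans (u.prodCongr MulEquiv.prodUnits))⟩
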